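/- Let $(M,\mathcal S)$ be a model of $\mathsf{RCA}_0$: $M$ is a discretely ordered commutative semiring with identity, $\mathcal S$ is a collection of subsets of $M$, and $(M,\mathcal S)$ satisfies $\Sigma^0_1$ induction and $\Delta^0_1$ comprehension (with number and set parameters). We reason inside this arbitrary model; by the completeness theorem, the claim says exactly that $\mathsf{RCA}_0$ proves the equivalence below. Thus "$\mathbb N$" means $M$, "set" means a member of $\mathcal S$, functions are sets of coded pairs, $\mathcal P_{\mathrm f}(I)$ is the collection of codes of finite subsets of $I$, and a sequence $(U_i)_{i\in I}$ of subsets of $X$ is coded by the set of pairs $(x,i)$ with $i \in I$ and $x\in U_i$. A countable second-countable space is a triple $(X,\mathcal U,k)$ consisting of a set $X$, a sequence $\mathcal U=(U_i)_{i\in I}$ of subsets of $X$, and a function $k\colon X\times I\times I\to I$, such that each $x\in X$ lies in some $U_i$, and $x\in U_i\cap U_j$ implies $x\in U_{k(x,i,j)}\subseteq U_i\cap U_j$. For a set $X'\subseteq X$, the corresponding subspace is $(X',(U_i\cap X')_{i\in I},k\restriction (X'\times I\times I))$. A function $h\colon\mathbb N\to\mathcal P_{\mathrm f}(I)$ codes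 the effectively open set $G_h=\bigcup_{n\in\mathbb N}\bigcup_{i\in h(n)}U_i$ and the effectively closed set $F_h=X\setminus G_h$; these are definable collections that need not be sets of the model. A function $g\colon\mathbb N\times\mathbb N\to\mathcal P_{\mathrm f}(I)$ codes the sequence $(G_n)_{n\in\mathbb N}$ of effectively open sets $G_n=G_{g(n,\cdot)}$ and the sequence $(F_n)_{n\in\mathbb N}$ of effectively closed sets $F_n=F_{g(n,\cdot)}$. The space is compact if for every $h\colon\mathbb N\to\mathcal P_{\mathrm f}(I)$ with $X=G_h$ there is an $N\in\mathbb N$ with $X=\bigcup_{n<N}\bigcup_{i\in h(n)}U_i$. An effectively open set $G_h$ is compact if for every $f\colon\mathbb N\to\mathcal P_{\mathrm f}(I)$ with $G_h\subseteq G_f$ there is an $N\in\mathbb N$ with $G_h\subseteq\bigcup_{n<N}\bigcup_{i\in f(n)}U_i$. **Proposition 3.1** (over $\mathsf{RCA}_0$). For a countable second-countable space $(X,\mathcal U,k)$, the following statements are equivalent. (i) Every effectively open set is compact. (ii) For every effectively open set $G_h$, there is an $N\in\mathbb N$ such that $G_h=\bigcup_{n<N}\bigcup_{i\in h(n)}U_i$.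 (iii) Every subspace is compact. (iv) For every sequence $(G_n)_{n\in\mathbb N}$ of effectively open sets such that $\forall n\,(G_n\subseteq G_{n+1})$, there is an $N$ such that $(\forall n>N)(G_n=G_N)$. (v) For every sequence $(F_n)_{n\in\mathbb N}$ of effectively closed sets such that $\forall n\,(F_n\supseteq F_{n+1})$, there is an $N$ such that $(\forall n>N)(F_n=F_N)$. -/

import Mathlib

namespace RevMath

universe u

/-! ## The language of second-order arithmetic and the theory RCA₀

A structure for second-order arithmetic is a set `M` of numbers, here a commutative semiring with
a linear order, together with a nonempty family `S : Set (Set M)` of subsets of `M`, over which the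
set variables range. Provability in RCA₀ means, by completeness, truth in all of its models. -/

/-- Number terms; variables are de Bruijn indices. -/
inductive Term : Type
  | var : ℕ → Term
  | zero : Term
  | one : Term
  | add : Term → Term → Term
  | mul : Term → Term → Term

/-- Bounded-quantifier formulas, with free number variables and free set variables. In
`bex t φ` (meaning `∃ x < t, φ`) the variable `x` is the variable `0` of `φ`, the other number
variables are shifted by one in `φ`, and `t` does not contain `x`. The other connectives and the
bounded universal quantifier are obtained from these by negation. -/
inductive BddFormula : Type
  | eq : Term → Term → BddFormula
  | lt : Term → Term → BddFormula
  | mem : Term → ℕ → BddFormula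
  | neg : BddFormula → BddFormula
  | and : BddFormula → BddFormula → BddFormula
  | bex : Term → BddFormula → BddFormula

/-- The assignment `a, v 0, v 1, …`. -/
def push {M : Type u} (a : M) (v : ℕ → M) : ℕ → M
  | 0 => a
  | n + 1 => v n

/-- The value of a term under an assignment of the number variables. -/
def Term.eval {M : Type u} [CommSemiring M] (v : ℕ → M) : Term → M
  | .var n => v n
  | .zero => 0
  | .one => 1
  | .add t s => t.eval v + s.eval v
  | .mul t s => t.eval v * s.eval v

/-- Truth of a bounded-quantifier formula, under an assignment `A` of the set variables and an
assignment `v` of the number variables. -/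
def BddFormula.Realize {M : Type u} [CommSemiring M] [LinearOrder M] (A : ℕ → Set M) :
    BddFormula → (ℕ → M) → Prop
  | .eq t s, v => t.eval v = s.eval v
  | .lt t s, v => t.eval v < s.eval v
  | .mem t i, v => t.eval v ∈ A i
  | .neg φ, v => ¬ φ.Realize A v
  | .and φ ψ, v => φ.Realize A v ∧ ψ.Realize A v
  | .bex t φ, v => ∃ x, x < t.eval v ∧ φ.Realize A (push x v)

/-- The `Σ⁰₁` formula `∃ m, θ(m, n, …)`, evaluated at `n`; the remaining number variables
and the set variables are parameters. -/
def SigmaOne {M : Type u} [CommSemiring M] [LinearOrder M]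
    (θ : BddFormula) (A : ℕ → Set M) (v : ℕ → M) (n : M) : Prop :=
  ∃ m, θ.Realize A (push m (push n v))

/-- The `Π⁰₁` formula `∀ m, θ(m, n, …)`, evaluated at `n`. -/
def PiOne {M : Type u} [CommSemiring M] [LinearOrder M]
    (θ : BddFormula) (A : ℕ → Set M) (v : ℕ → M) (n : M) : Prop :=
  ∀ m, θ.Realize A (push m (push n v))

/-- `(M, S)` is a model of RCA₀: `M` is a discretely ordered commutative semiring with identity,
and `(M, S)` satisfies `Σ⁰₁` induction and `Δ⁰₁` comprehension, both with number parameters from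
`M` and set parameters from `S`. -/
structure IsModelRCA0 (M : Type u) [CommSemiring M] [LinearOrder M] [IsStrictOrderedRing M]
    (S : Set (Set M)) : Prop where
  /-- the sort of sets is nonempty, as is every sort of a structure -/
  nonempty : S.Nonempty
  discrete : ∀ a : M, 0 < a → 1 ≤ a
  induction : ∀ (θ : BddFormula) (A : ℕ → Set M) (v : ℕ → M), (∀ i, A i ∈ S) →
    SigmaOne θ A v 0 → (∀ n, SigmaOne θ A v n → SigmaOne θ A v (n + 1)) →
    ∀ n, SigmaOne θ A v n
  comprehension : ∀ (θ η : BddFormula) (A : ℕ → Set M) (v : ℕ → M), (∀ i, A i ∈ S) →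
    (∀ n, SigmaOne θ A v n ↔ PiOne η A v n) → {n | SigmaOne θ A v n} ∈ S

/-! ## Pairs, functions and finite sets inside second-order arithmetic -/

section Coding

variable {M : Type u} [CommSemiring M]

/-- The usual code of an ordered pair of numbers. -/
def pair (a b : M) : M := (a + b) ^ 2 + a

/-- `A × B`, as a collection of codes of pairs. -/
def prod (A B : Set M) : Set M := {p | ∃ a ∈ A, ∃ b ∈ B, p = pair a b}

/-- `F` is (the graph of) a function from `A` to `B`. -/
def IsFunction (F A B : Set M) : Prop :=
  F ⊆ prod A B ∧ ∀ a ∈ A, ∃! b, pair a b ∈ F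

/-- `e` has the form `(k, (m, n))`. -/
def IsTriple (e : M) : Prop := ∃ k m n : M, e = pair k (pair m n)

variable [LinearOrder M]

/-- The finite set coded by the triple `e = (k, (m, n))`: those `i < k` for which
`m * (i + 1) + 1` divides `n`. -/
def decode (e : M) : Set M :=
  {i | ∃ k m n : M, e = pair k (pair m n) ∧ i < k ∧ m * (i + 1) + 1 ∣ n}

/-- `e` is the code of a finite set, that is, the least triple that codes this set. -/
def IsFinsetCode (e : M) : Prop :=
  IsTriple e ∧ ∀ e' < e, IsTriple e' → decode e' ≠ decode e

/-- The collection of (codes of) finite subsets of `I`. -/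
def finSubsets (I : Set M) : Set M := {e | IsFinsetCode e ∧ decode e ⊆ I}

end Coding

/-! ## Countable second-countable spaces -/

/-- The data `(X, (U i) (i ∈ I), k)` of a countable second-countable space; the sequence `U` is
given by the set of the pairs `(x, i)` with `x ∈ U i`. -/
structure SpaceData (M : Type u) where
  /-- the set of points -/
  X : Set M
  /-- the index set of the base -/
  I : Set M
  /-- the sequence of basic open sets -/
  U : Set M
  /-- the graph of the function `k : X × I × I → I` -/
  k : Set M

section Spaces

variable {M : Type u} [CommSemiring M]

namespace SpaceData

/-- The basic open set with index `i`. -/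
def basic (D : SpaceData M) (i : M) : Set M := {x | pair x i ∈ D.U}

/-- The subspace on `Y ⊆ X`: the basic open sets are intersected with `Y`, and `k` is restricted
to `Y × I × I`. -/
def subspace (D : SpaceData M) (Y : Set M) : SpaceData M where
  X := Y
  I := D.I
  U := {p | p ∈ D.U ∧ ∃ x ∈ Y, ∃ i ∈ D.I, p = pair x i}
  k := {p | p ∈ D.k ∧ ∃ x ∈ Y, ∃ i ∈ D.I, ∃ j ∈ D.I, ∃ l ∈ D.I,
    p = pair (pair (pair x i) j) l}

end SpaceData

/-- `D` is a countable second-countable space in the sense of `(M, S)`. -/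
structure IsCSCSpace (S : Set (Set M)) (D : SpaceData M) : Prop where
  mem_X : D.X ∈ S
  mem_I : D.I ∈ S
  mem_U : D.U ∈ S
  mem_k : D.k ∈ S
  U_subset : D.U ⊆ prod D.X D.I
  k_function : IsFunction D.k (prod (prod D.X D.I) D.I) D.I
  cover : ∀ x ∈ D.X, ∃ i ∈ D.I, x ∈ D.basic i
  inter : ∀ x i j l : M, pair (pair (pair x i) j) l ∈ D.k →
    x ∈ D.basic i ∩ D.basic j →
    x ∈ D.basic l ∧ D.basic l ⊆ D.basic i ∩ D.basic j

variable [LinearOrder M]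

namespace SpaceData

/-- `h` is a function `ℕ → P_f(I)` of `(M, S)`: a code of an effectively open (or closed) set. -/
def IsCode (S : Set (Set M)) (D : SpaceData M) (h : Set M) : Prop :=
  h ∈ S ∧ IsFunction h Set.univ (finSubsets D.I)

/-- The effectively open set `G_h`, the union of the `U i` over all `n` and all `i ∈ h n`. It is a
definable collection of numbers, not necessarily a member of `S`. -/
def effOpen (D : SpaceData M) (h : Set M) : Set M :=
  {x | ∃ n e i : M, pair n e ∈ h ∧ i ∈ decode e ∧ x ∈ D.basic i}

/-- The union of the `U i` over all `n < N` and all `i ∈ h n`. -/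
def effOpenBelow (D : SpaceData M) (h : Set M) (N : M) : Set M :=
  {x | ∃ n e i : M, n < N ∧ pair n e ∈ h ∧ i ∈ decode e ∧ x ∈ D.basic i}

/-- The effectively closed set `F_h`. -/
def effClosed (D : SpaceData M) (h : Set M) : Set M := D.X \ D.effOpen h

/-- `g` is a function `ℕ × ℕ → P_f(I)` of `(M, S)`: a code of a sequence of effectively open
(or closed) sets. -/
def IsSeqCode (S : Set (Set M)) (D : SpaceData M) (g : Set M) : Prop :=
  g ∈ S ∧ IsFunction g (prod Set.univ Set.univ) (finSubsets D.I)

/-- The space is compact, in the sense of `(M, S)`. -/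
def IsCompact (S : Set (Set M)) (D : SpaceData M) : Prop :=
  ∀ h, D.IsCode S h → D.X = D.effOpen h → ∃ N : M, D.X = D.effOpenBelow h N

/-- The effectively open set `G_h` is compact, in the sense of `(M, S)`. -/
def IsCompactEffOpen (S : Set (Set M)) (D : SpaceData M) (h : Set M) : Prop :=
  ∀ f, D.IsCode S f → D.effOpen h ⊆ D.effOpen f →
    ∃ N : M, D.effOpen h ⊆ D.effOpenBelow f N

end SpaceData

/-- The function `g(n, ·)`, for a function `g` of two arguments. -/
def row (g : Set M) (n : M) : Set M :=
  {p | ∃ m e : M, p = pair m e ∧ pair (pair n m) e ∈ g}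

end Spaces

end RevMath

/-!
The equivalence of (i), (ii), (iv) and (v) is a matter of coding: the finite stages of the
enumeration `h` form an increasing sequence with union `G_h`, an increasing sequence of effectively
open sets is enumerated by a single `h`, and complements exchange open and closed sets.

The main point is (iii) → (ii). A set of the model included in `G_h` is a compact subspace covered
by `h`, hence is included in one of the finite stages. First apply this to the diagonal set of the
`x` that have been enumerated by stage `x`: if `c` is the resulting stage, then every `x` that is
enumerated only after stage `c` is also enumerated only after stage `x`. Were these late elements
unbounded, there would be an unbounded set of the model consisting of late elements; it is included
in some stage `N`, but a late element that has been enumerated by stage `N` is less than `N`. So the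
late elements are bounded, and bounded `Σ⁰₁` comprehension makes `G_h` itself a set of the model.
Bounded `Σ⁰₁` comprehension in turn comes from the coding of finite sets by divisibility.
-/

namespace RevMath

/-! ## Definability by bounded formulas -/

section Definability

/-- Renaming of the number variables of a term. -/
def Term.rename (f : ℕ → ℕ) : Term → Term
  | .var n => .var (f n)
  | .zero => .zero
  | .one => .one
  | .add t s => .add (t.rename f) (s.rename f)
  | .mul t s => .mul (t.rename f) (s.rename f)

/-- Renaming of the free number variables of a bounded formula by `f` and of its set variables
by `g`. -/
def BddFormula.rename (f g : ℕ → ℕ) : BddFormula → BddFormula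
  | .eq t s => .eq (t.rename f) (s.rename f)
  | .lt t s => .lt (t.rename f) (s.rename f)
  | .mem t i => .mem (t.rename f) (g i)
  | .neg φ => .neg (φ.rename f g)
  | .and φ ψ => .and (φ.rename f g) (ψ.rename f g)
  | .bex t φ => .bex (t.rename f) (φ.rename (push 0 fun n => f n + 1) g)

theorem push_comp_push_zero {M : Type*} (x : M) (v : ℕ → M) (f : ℕ → ℕ) :
    push x v ∘ push 0 (fun n => f n + 1) = push x (v ∘ f) := by
  ext (_ | n) <;> rfl

/-- The sequence with `f` on the even and `g` on the odd indices; it merges the parameters of two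
formulas. -/
def interleave {α : Type*} (f g : ℕ → α) : ℕ → α :=
  Sum.elim f g ∘ Equiv.natSumNatEquivNat.symm

/-- The index of `f i` in `interleave f g`. -/
def evenVar (i : ℕ) : ℕ := Equiv.natSumNatEquivNat (.inl i)

/-- The index of `g i` in `interleave f g`. -/
def oddVar (i : ℕ) : ℕ := Equiv.natSumNatEquivNat (.inr i)

theorem interleave_comp_evenVar {α : Type*} (f g : ℕ → α) : interleave f g ∘ evenVar = f := by
  ext i
  simp only [interleave, evenVar, Function.comp_apply, Equiv.symm_apply_apply, Sum.elim_inl]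

theorem interleave_comp_oddVar {α : Type*} (f g : ℕ → α) : interleave f g ∘ oddVar = g := by
  ext i
  simp only [interleave, oddVar, Function.comp_apply, Equiv.symm_apply_apply, Sum.elim_inr]

theorem interleave_mem {α : Type*} {B : Set α} {f g : ℕ → α} (hf : ∀ i, f i ∈ B)
    (hg : ∀ i, g i ∈ B) (i : ℕ) : interleave f g i ∈ B := by
  rw [interleave, Function.comp_apply]
  cases Equiv.natSumNatEquivNat.symm i
  exacts [hf _, hg _]

variable {M : Type*} [CommSemiring M]

theorem Term.eval_rename (f : ℕ → ℕ) (v : ℕ → M) (t : Term) :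
    (t.rename f).eval v = t.eval (v ∘ f) := by
  induction t <;> simp_all [Term.rename, Term.eval]

/-- The function `t` of the variables `v` is given by a term with parameters from `M`: each variable
of the term stands for one of the variables `v`, or for a parameter. -/
class TermDefinable (t : (ℕ → M) → M) : Prop where
  out : ∃ (s : Term) (f : ℕ → ℕ ⊕ M), ∀ v, s.eval (Sum.elim v id ∘ f) = t v

variable {s t : (ℕ → M) → M}

instance TermDefinable.var (i : ℕ) : TermDefinable fun v : ℕ → M => v i :=
  ⟨.var i, .inl, fun _ => rfl⟩

instance TermDefinable.const (c : M) : TermDefinable fun _ : ℕ → M => c :=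
  ⟨.var 0, fun _ => .inr c, fun _ => rfl⟩

theorem TermDefinable.reindex [ht : TermDefinable t] (σ : ℕ → ℕ) :
    TermDefinable fun v => t (v ∘ σ) :=
  let ⟨a, f, ha⟩ := ht.out
  ⟨a, Sum.map σ id ∘ f, fun v => by rw [← ha, ← Function.comp_assoc, Sum.elim_comp_map]; rfl⟩

theorem TermDefinable.exists_common [hs : TermDefinable s] [ht : TermDefinable t] :
    ∃ (a b : Term) (f : ℕ → ℕ ⊕ M), ∀ v,
      a.eval (Sum.elim v id ∘ f) = s v ∧ b.eval (Sum.elim v id ∘ f) = t v :=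
  let ⟨a, f, ha⟩ := hs.out
  let ⟨b, g, hb⟩ := ht.out
  ⟨a.rename evenVar, b.rename oddVar, interleave f g, fun v => by
    simp only [Term.eval_rename, Function.comp_assoc, interleave_comp_evenVar,
      interleave_comp_oddVar, ha, hb, and_self]⟩

instance TermDefinable.add [TermDefinable s] [TermDefinable t] :
    TermDefinable fun v => s v + t v :=
  let ⟨a, b, f, h⟩ := exists_common (s := s) (t := t)
  ⟨.add a b, f, fun v => congrArg₂ (· + ·) (h v).1 (h v).2⟩

instance TermDefinable.mul [TermDefinable s] [TermDefinable t] :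
    TermDefinable fun v => s v * t v :=
  let ⟨a, b, f, h⟩ := exists_common (s := s) (t := t)
  ⟨.mul a b, f, fun v => congrArg₂ (· * ·) (h v).1 (h v).2⟩

instance TermDefinable.pair [TermDefinable s] [TermDefinable t] :
    TermDefinable fun v => pair (s v) (t v) := by
  simp only [RevMath.pair, sq]
  infer_instance

variable [LinearOrder M]

theorem BddFormula.realize_rename (A : ℕ → Set M) (φ : BddFormula) (f g : ℕ → ℕ) (v : ℕ → M) :
    (φ.rename f g).Realize A v ↔ φ.Realize (A ∘ g) (v ∘ f) := by
  induction φ generalizing f v with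
  | bex t φ ih => simp [rename, Realize, Term.eval_rename, ih, push_comp_push_zero]
  | _ => simp_all [rename, Realize, Term.eval_rename]

/-- The predicate `P` of the variables `v` is given by a bounded formula with number parameters from
`M` and set parameters from `S`. The empty set is a parameter too, so that a formula without set
variables needs no member of `S`. -/
class BddDefinable (S : Set (Set M)) (P : (ℕ → M) → Prop) : Prop where
  out : ∃ (θ : BddFormula) (A : ℕ → Set M) (f : ℕ → ℕ ⊕ M), (∀ i, A i ∈ insert ∅ S) ∧
    ∀ v, θ.Realize A (Sum.elim v id ∘ f) ↔ P v

variable {S : Set (Set M)} {P Q : (ℕ → M) → Prop}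

namespace BddDefinable

theorem congr (h : BddDefinable S P) (hPQ : ∀ v, P v ↔ Q v) : BddDefinable S Q :=
  (funext fun v => propext (hPQ v) : P = Q) ▸ h

theorem reindex [hP : BddDefinable S P] (σ : ℕ → ℕ) : BddDefinable S fun v => P (v ∘ σ) :=
  let ⟨θ, A, f, hA, hθ⟩ := hP.out
  ⟨θ, A, Sum.map σ id ∘ f, hA, fun v => by
    rw [← hθ, ← Function.comp_assoc, Sum.elim_comp_map]; rfl⟩

instance eq [TermDefinable s] [TermDefinable t] : BddDefinable S fun v => s v = t v :=
  let ⟨a, b, f, h⟩ := TermDefinable.exists_common (s := s) (t := t)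
  ⟨.eq a b, fun _ => ∅, f, fun _ => Set.mem_insert _ _, fun v => by
    rw [BddFormula.Realize, (h v).1, (h v).2]⟩

instance lt [TermDefinable s] [TermDefinable t] : BddDefinable S fun v => s v < t v :=
  let ⟨a, b, f, h⟩ := TermDefinable.exists_common (s := s) (t := t)
  ⟨.lt a b, fun _ => ∅, f, fun _ => Set.mem_insert _ _, fun v => by
    rw [BddFormula.Realize, (h v).1, (h v).2]⟩

instance mem (B : Set M) [hB : Fact (B ∈ S)] [ht : TermDefinable t] :
    BddDefinable S fun v => t v ∈ B :=
  let ⟨a, f, ha⟩ := ht.out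
  ⟨.mem a 0, fun _ => B, f, fun _ => Set.mem_insert_of_mem _ hB.out, fun v => by
    rw [BddFormula.Realize, ha]⟩

instance not [hP : BddDefinable S P] : BddDefinable S fun v => ¬ P v :=
  let ⟨θ, A, f, hA, hθ⟩ := hP.out
  ⟨.neg θ, A, f, hA, fun v => not_congr (hθ v)⟩

theorem exists_common [hP : BddDefinable S P] [hQ : BddDefinable S Q] :
    ∃ (θ η : BddFormula) (A : ℕ → Set M) (f : ℕ → ℕ ⊕ M), (∀ i, A i ∈ insert ∅ S) ∧
      ∀ v, (θ.Realize A (Sum.elim v id ∘ f) ↔ P v) ∧ (η.Realize A (Sum.elim v id ∘ f) ↔ Q v) :=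
  let ⟨θ, A, f, hA, hθ⟩ := hP.out
  let ⟨η, B, g, hB, hη⟩ := hQ.out
  ⟨θ.rename evenVar evenVar, η.rename oddVar oddVar, interleave A B, interleave f g,
    interleave_mem hA hB, fun v => by
      simp only [BddFormula.realize_rename, Function.comp_assoc, interleave_comp_evenVar,
        interleave_comp_oddVar, hθ, hη, and_self]⟩

instance and [BddDefinable S P] [BddDefinable S Q] : BddDefinable S fun v => P v ∧ Q v :=
  let ⟨θ, η, A, f, hA, h⟩ := exists_common (S := S) (P := P) (Q := Q)
  ⟨.and θ η, A, f, hA, fun v => and_congr (h v).1 (h v).2⟩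

instance or [BddDefinable S P] [BddDefinable S Q] : BddDefinable S fun v => P v ∨ Q v :=
  (inferInstance : BddDefinable S fun v => ¬ (¬ P v ∧ ¬ Q v)).congr fun _ => by tauto

instance imp [BddDefinable S P] [BddDefinable S Q] : BddDefinable S fun v => P v → Q v :=
  (inferInstance : BddDefinable S fun v => ¬ (P v ∧ ¬ Q v)).congr fun _ => by tauto

instance le [TermDefinable s] [TermDefinable t] : BddDefinable S fun v => s v ≤ t v :=
  (inferInstance : BddDefinable S fun v => ¬ t v < s v).congr fun _ => not_lt

instance exists_lt {Q : M → (ℕ → M) → Prop} [ht : TermDefinable t]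
    [hQ : BddDefinable S fun u => Q (u 0) fun i => u (i + 1)] :
    BddDefinable S fun v => ∃ x, x < t v ∧ Q x v := by
  obtain ⟨a, f, ha⟩ := ht.out
  obtain ⟨θ, A, g, hA, hθ⟩ := hQ.out
  let r (n : ℕ) : ℕ := if g n = .inl 0 then 0 else oddVar n + 1
  let f' : ℕ → ℕ ⊕ M := interleave f (Sum.map Nat.pred id ∘ g)
  have env (x : M) (v : ℕ → M) : push x (Sum.elim v id ∘ f') ∘ r = Sum.elim (push x v) id ∘ g := by
    ext n
    have hf' : f' (oddVar n) = Sum.map Nat.pred id (g n) :=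
      congrFun (interleave_comp_oddVar f (Sum.map Nat.pred id ∘ g)) n
    rcases hn : g n with (_ | j) | c <;> simp [r, hn, hf', push]
  refine ⟨.bex (a.rename evenVar) (θ.rename r id), A, f', hA, fun v => ?_⟩
  simp only [BddFormula.Realize, Term.eval_rename, BddFormula.realize_rename, env, Function.comp_id,
    Function.comp_assoc, f', interleave_comp_evenVar, ha]
  exact exists_congr fun x => and_congr_right fun _ => hθ (push x v)

instance forall_lt {Q : M → (ℕ → M) → Prop} [TermDefinable t]
    [BddDefinable S fun u => Q (u 0) fun i => u (i + 1)] :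
    BddDefinable S fun v => ∀ x, x < t v → Q x v :=
  (inferInstance : BddDefinable S fun v => ¬ ∃ x, x < t v ∧ ¬ Q x v).congr fun _ => by
    simp only [not_exists, not_and, not_not]

theorem exists_realize_iff (R T : M → M → Prop) [BddDefinable S fun v => R (v 0) (v 1)]
    [BddDefinable S fun v => T (v 0) (v 1)] :
    ∃ (θ η : BddFormula) (A : ℕ → Set M) (w : ℕ → M), (∀ i, A i ∈ insert ∅ S) ∧ ∀ m n,
      (θ.Realize A (push m (push n w)) ↔ R m n) ∧ (η.Realize A (push m (push n w)) ↔ T m n) := by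
  obtain ⟨θ, η, A, f, hA, h⟩ :=
    exists_common (S := S) (P := fun v => R (v 0) (v 1)) (Q := fun v => T (v 0) (v 1))
  let r (i : ℕ) : ℕ := Sum.elim (fun j => min j 1) (fun _ => i + 2) (f i)
  let w (i : ℕ) : M := Sum.elim 0 id (f i)
  have env (m n : M) : push m (push n w) ∘ r = Sum.elim (push m fun _ => n) id ∘ f := by
    ext i
    rcases hi : f i with (_ | j) | c <;> simp [r, w, hi, push]
  refine ⟨θ.rename r id, η.rename r id, A, w, hA, fun m n => ?_⟩
  simp only [BddFormula.realize_rename, env, Function.comp_id]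
  exact h (push m fun _ => n)

end BddDefinable

variable [IsStrictOrderedRing M]

namespace IsModelRCA0

variable (hM : IsModelRCA0 M S)
include hM

theorem empty_mem : ∅ ∈ S := by
  obtain ⟨B, hB⟩ := hM.nonempty
  simpa [SigmaOne, PiOne, BddFormula.Realize] using
    hM.comprehension (.neg (.eq .zero .zero)) (.neg (.eq .zero .zero)) (fun _ => B) (fun _ => 0)
      (fun _ => hB) (by simp [SigmaOne, PiOne, BddFormula.Realize])

theorem sigma_induction (R : M → M → Prop) [BddDefinable S fun v => R (v 0) (v 1)]
    (zero : ∃ m, R m 0) (succ : ∀ n, (∃ m, R m n) → ∃ m, R m (n + 1)) (n : M) : ∃ m, R m n := by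
  obtain ⟨θ, _, A, w, hA, hθ⟩ := BddDefinable.exists_realize_iff (S := S) R R
  rw [Set.insert_eq_of_mem hM.empty_mem] at hA
  have key (n : M) : SigmaOne θ A w n ↔ ∃ m, R m n := exists_congr fun m => (hθ m n).1
  simp only [← key] at zero succ ⊢
  exact hM.induction θ A w hA zero succ n

theorem delta_comprehension (R T : M → M → Prop) [BddDefinable S fun v => R (v 0) (v 1)]
    [BddDefinable S fun v => T (v 0) (v 1)] (h : ∀ n, (∃ m, R m n) ↔ ∀ m, T m n) :
    {n | ∃ m, R m n} ∈ S := by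
  obtain ⟨θ, η, A, w, hA, hθη⟩ := BddDefinable.exists_realize_iff (S := S) R T
  rw [Set.insert_eq_of_mem hM.empty_mem] at hA
  have key (n : M) : SigmaOne θ A w n ↔ ∃ m, R m n := exists_congr fun m => (hθη m n).1
  have key' (n : M) : PiOne η A w n ↔ ∀ m, T m n := forall_congr' fun m => (hθη m n).2
  simp only [← key, ← key'] at h ⊢
  exact hM.comprehension θ η A w hA h

theorem bdd_induction (R : M → Prop) [BddDefinable S fun v => R (v 0)] (zero : R 0)
    (succ : ∀ n, R n → R (n + 1)) (n : M) : R n := by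
  have : BddDefinable S fun v => R (v 1) := .reindex (P := fun v => R (v 0)) fun _ => 1
  simpa using hM.sigma_induction (fun _ n => R n) (by simpa using zero) (by simpa using succ) n

theorem bdd_comprehension (R : M → Prop) [BddDefinable S fun v => R (v 0)] : {n | R n} ∈ S := by
  have : BddDefinable S fun v => R (v 1) := .reindex (P := fun v => R (v 0)) fun _ => 1
  simpa using hM.delta_comprehension (fun _ n => R n) (fun _ n => R n) (by simp)

end IsModelRCA0

end Definability

/-! ## Arithmetic -/

/-- The numbers form a discretely ordered semiring whose order is the natural order of the
addition, as in the nonnegative part of a discretely ordered ring. -/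
class IsDiscretelyOrdered (M : Type*) [CommSemiring M] [LinearOrder M] : Prop
    extends CanonicallyOrderedAdd M where
  one_le_of_pos (a : M) : 0 < a → 1 ≤ a

namespace IsModelRCA0

variable {M : Type*} [CommSemiring M] [LinearOrder M] [IsStrictOrderedRing M] {S : Set (Set M)}
  (hM : IsModelRCA0 M S)
include hM

theorem nonneg (a : M) : 0 ≤ a :=
  hM.bdd_induction (fun a => 0 ≤ a) le_rfl (fun _ ha => add_nonneg ha zero_le_one) a

theorem eq_zero_or_exists_add_one (a : M) : a = 0 ∨ ∃ b < a, a = b + 1 :=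
  hM.bdd_induction (fun a => a = 0 ∨ ∃ b < a, a = b + 1) (.inl rfl)
    (fun a _ => .inr ⟨a, lt_add_one a, rfl⟩) a

theorem add_one_le {a b : M} (h : a < b) : a + 1 ≤ b := by
  refine hM.bdd_induction (fun b => ∀ a' < a + 1, a' < b → a' + 1 ≤ b) ?_ ?_ b a (lt_add_one a) h
  · exact fun a' _ ha' => absurd ha' (hM.nonneg a').not_gt
  · intro b ih a' ha' hb
    rcases hM.eq_zero_or_exists_add_one a' with rfl | ⟨c, hc, rfl⟩
    · simpa using hM.nonneg b
    · exact add_le_add_left (ih c (hc.trans ha') (lt_of_add_lt_add_right hb)) 1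

theorem exists_add_of_le {a b : M} (h : a ≤ b) : ∃ c, b = a + c := by
  refine (hM.sigma_induction (fun c n => n = a + c ∨ n < a) ?_ ?_ b).imp
    fun c hc => hc.resolve_right h.not_gt
  · exact ⟨0, (hM.nonneg a).eq_or_lt.imp (by simpa using ·) id⟩
  · rintro n ⟨c, rfl | hn⟩
    · exact ⟨c + 1, .inl (add_assoc _ _ _)⟩
    · exact ⟨0, (hM.add_one_le hn).eq_or_lt.imp_left (by rw [·, add_zero])⟩

theorem isDiscretelyOrdered : IsDiscretelyOrdered M where
  exists_add_of_le := hM.exists_add_of_le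
  le_add_self _ b := le_add_of_nonneg_left (hM.nonneg b)
  le_self_add _ b := le_add_of_nonneg_right (hM.nonneg b)
  one_le_of_pos := hM.discrete

end IsModelRCA0

section Pairing

variable {M : Type*} [CommSemiring M]

theorem pair_zero_zero : pair (0 : M) 0 = 0 := by simp [pair]

variable [LinearOrder M] [IsDiscretelyOrdered M]

theorem le_pair_left (a b : M) : a ≤ pair a b := le_add_self

theorem exists_eq_add_one {a : M} (h : a ≠ 0) : ∃ b, a = b + 1 :=
  (exists_add_of_le (IsDiscretelyOrdered.one_le_of_pos a (pos_iff_ne_zero.2 h))).imp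
    fun _ hb => hb.trans (add_comm _ _)

theorem lt_of_mem_decode {i e : M} (h : i ∈ decode e) : i < e := by
  obtain ⟨k, m, n, rfl, hi, -⟩ := h
  exact hi.trans_le (le_pair_left _ _)

theorem decode_zero : decode (0 : M) = ∅ :=
  Set.eq_empty_of_forall_notMem fun _ h => (lt_of_mem_decode h).not_ge zero_le

theorem zero_mem_finSubsets (I : Set M) : (0 : M) ∈ finSubsets I :=
  ⟨⟨⟨0, 0, 0, by simp only [pair_zero_zero]⟩, fun _ h => absurd h zero_le.not_gt⟩,
    by simp only [decode_zero, Set.empty_subset]⟩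

variable [IsStrictOrderedRing M]

instance : SuccOrder M :=
  .ofSuccLeIff (· + 1) fun {a b} => by
    refine ⟨(lt_add_one a).trans_le, fun h => ?_⟩
    obtain ⟨c, rfl⟩ := exists_add_of_le h.le
    exact add_le_add_right
      (IsDiscretelyOrdered.one_le_of_pos c ((lt_add_iff_pos_right a).1 h)) a

instance : SuccAddOrder M := ⟨fun _ => rfl⟩

theorem le_mul_of_ne_zero {a b : M} (h : a ≠ 0) : b ≤ a * b :=
  le_mul_of_one_le_left zero_le (Order.one_le_iff_pos.2 (pos_iff_ne_zero.2 h))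

theorem dvd_of_dvd_add {a b c : M} (h : a ∣ b + c) (hb : a ∣ b) : a ∣ c := by
  obtain ⟨u, rfl⟩ := hb
  obtain ⟨v, hv⟩ := h
  rcases le_total u v with huv | hvu
  · obtain ⟨w, rfl⟩ := exists_add_of_le huv
    exact ⟨w, add_left_cancel (hv.trans (mul_add a u w))⟩
  · have hc : a * u + c = a * u :=
      le_antisymm (hv.trans_le (mul_le_mul_right hvu a)) le_self_add
    rw [add_eq_left.1 hc]
    exact dvd_zero a

theorem pair_lt_pair {a b c d : M} (h : a + b < c + d) : pair a b < pair c d :=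
  calc pair a b ≤ pair a b + (a + b + b) := le_self_add
    _ < pair a b + (a + b + b) + 1 := lt_add_one _
    _ = (a + b + 1) ^ 2 := by rw [pair]; ring
    _ ≤ (c + d) ^ 2 := pow_le_pow_left₀ zero_le (Order.add_one_le_of_lt h) 2
    _ ≤ pair c d := le_self_add

theorem pair_inj {a b c d : M} : pair a b = pair c d ↔ a = c ∧ b = d := by
  refine ⟨fun h => ?_, by rintro ⟨rfl, rfl⟩; rfl⟩
  have hsum : a + b = c + d :=
    le_antisymm (not_lt.1 fun hlt => (pair_lt_pair hlt).ne' h)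
      (not_lt.1 fun hlt => (pair_lt_pair hlt).ne h)
  obtain rfl : a = c := by
    rw [pair, pair, hsum] at h
    exact add_left_cancel h
  exact ⟨rfl, add_left_cancel hsum⟩

theorem le_pair_right (a b : M) : b ≤ pair a b := by
  rcases eq_or_ne b 0 with rfl | hb
  · exact zero_le
  · calc b ≤ a + b := le_add_self
      _ ≤ (a + b) * (a + b) := le_mul_of_ne_zero (by simp [hb])
      _ ≤ pair a b := by rw [pair, sq]; exact le_self_add

namespace BddDefinable

variable {S : Set (Set M)} {s t : (ℕ → M) → M}

instance exists_pair {Q : M → M → (ℕ → M) → Prop} [ht : TermDefinable t]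
    [BddDefinable S fun u => Q (u 1) (u 0) fun i => u (i + 2)] :
    BddDefinable S fun v => ∃ a b, t v = pair a b ∧ Q a b v :=
  have : TermDefinable fun u => t fun i => u (i + 1) := ht.reindex (· + 1)
  have : TermDefinable fun u => t fun i => u (i + 2) := ht.reindex (· + 2)
  (inferInstance : BddDefinable S fun v =>
    ∃ a < t v + 1, ∃ b < t v + 1, t v = pair a b ∧ Q a b v).congr fun _ =>
    ⟨fun ⟨a, _, b, _, h⟩ => ⟨a, b, h⟩, fun ⟨a, b, h⟩ =>
      ⟨a, Order.lt_add_one_iff.2 (h.1 ▸ le_pair_left a b),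
        b, Order.lt_add_one_iff.2 (h.1 ▸ le_pair_right a b), h⟩⟩

instance dvd [hs : TermDefinable s] [ht : TermDefinable t] :
    BddDefinable S fun v => s v ∣ t v :=
  have : TermDefinable fun u => s fun i => u (i + 1) := hs.reindex (· + 1)
  have : TermDefinable fun u => t fun i => u (i + 1) := ht.reindex (· + 1)
  (inferInstance : BddDefinable S fun v => ∃ q < t v + 1, t v = s v * q).congr fun _ => by
    refine ⟨fun ⟨q, _, hq⟩ => ⟨q, hq⟩, fun ⟨q, hq⟩ => ?_⟩
    rcases eq_or_ne (s _) 0 with h | h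
    · exact ⟨0, Order.lt_add_one_iff.2 zero_le, by rw [hq, h, zero_mul, mul_zero]⟩
    · exact ⟨q, Order.lt_add_one_iff.2 (hq ▸ le_mul_of_ne_zero h), hq⟩

instance mem_decode [hs : TermDefinable s] [TermDefinable t] :
    BddDefinable S fun v => s v ∈ decode (t v) :=
  have : TermDefinable fun u => s fun i => u (i + 4) := hs.reindex (· + 4)
  (inferInstance : BddDefinable S fun v => ∃ k p, t v = pair k p ∧ ∃ m n, p = pair m n ∧
    s v < k ∧ m * (s v + 1) + 1 ∣ n).congr fun v => by
      simp only [decode, Set.mem_ofPred_eq]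
      constructor
      · rintro ⟨k, _, hk, m, n, rfl, h⟩
        exact ⟨k, m, n, hk, h⟩
      · rintro ⟨k, m, n, hk, h⟩
        exact ⟨k, _, hk, m, n, rfl, h⟩

end BddDefinable

end Pairing

/-! ## Bounded `Σ⁰₁` comprehension -/

section Comprehension

variable {M : Type*} [CommSemiring M] [LinearOrder M] [IsStrictOrderedRing M] {S : Set (Set M)}

/-- The moduli of the coding of finite sets are coprime, in the form of Euclid's lemma. -/
theorem dvd_of_dvd_modulus_mul [IsDiscretelyOrdered M] {m b i j n : M}
    (hm : ∀ i < b, i + 1 ∣ m) (hi : i < b) (hj : j < b) (hij : i ≠ j)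
    (h : m * (j + 1) + 1 ∣ (m * (i + 1) + 1) * n) : m * (j + 1) + 1 ∣ n := by
  have dvd_m {c d : M} (hd : d ≠ 0) (hcd : c + d < b) : d ∣ m := by
    obtain ⟨d, rfl⟩ := exists_eq_add_one hd
    exact hm d ((lt_add_one d).trans (le_add_self.trans_lt hcd))
  obtain ⟨d, ⟨q, rfl⟩, hd⟩ : ∃ d, d ∣ m ∧ m * (j + 1) + 1 ∣ d * n := by
    rcases hij.lt_or_gt with hij | hij <;> obtain ⟨d, rfl⟩ := exists_add_of_le hij.le <;>
      refine ⟨d, dvd_m (by rintro rfl; simp at hij) ‹_›, ?_⟩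
    · refine dvd_of_dvd_add (b := (i + 1) * n * (m * (i + d + 1) + 1)) ?_ (dvd_mul_left _ _)
      exact (h.mul_left (i + d + 1)).trans (dvd_of_eq (by ring))
    · refine dvd_of_dvd_add (b := (j + 1) * ((m * (j + d + 1) + 1) * n)) ?_ (h.mul_left _)
      exact (dvd_mul_left _ ((j + d + 1) * n)).trans (dvd_of_eq (by ring))
  refine dvd_of_dvd_add (b := q * (j + 1) * (d * n)) ?_ (hd.mul_left _)
  exact (dvd_mul_left _ n).trans (dvd_of_eq (by ring))

namespace IsModelRCA0

variable (hM : IsModelRCA0 M S)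
include hM

theorem exists_common_multiple (f : M → M) (hf0 : ∀ i, f i ≠ 0)
    [TermDefinable fun v => f (v 0)] (b : M) : ∃ m, m ≠ 0 ∧ ∀ i < b, f i ∣ m := by
  have := hM.isDiscretelyOrdered
  refine hM.sigma_induction (fun m b => ¬ m = 0 ∧ ∀ i < b, f i ∣ m) ?_ ?_ b
  · exact ⟨1, one_ne_zero, fun i hi => absurd hi zero_le.not_gt⟩
  · rintro b ⟨m, hm0, hm⟩
    refine ⟨m * f b, mul_ne_zero hm0 (hf0 b), fun i hi => ?_⟩
    rcases (Order.lt_add_one_iff.1 hi).eq_or_lt with rfl | hi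
    · exact dvd_mul_left _ _
    · exact (hm i hi).mul_right _

theorem exists_least_of_forall (R : M → M → Prop) [BddDefinable S fun v => R (v 0) (v 1)] {a : M}
    (ha : ∀ m, R m a) : ∃ n, (∀ m, R m n) ∧ ∀ n' < n, ∃ m, ¬ R m n' := by
  have := hM.isDiscretelyOrdered
  by_contra! hno
  have bounded_counterexamples (n : M) : ∃ w, ∀ y < n, ∃ m < w, ¬ R m y := by
    refine hM.sigma_induction (fun w n => ∀ y < n, ∃ m < w, ¬ R m y) ?_ ?_ n
    · exact ⟨0, fun y hy => absurd hy zero_le.not_gt⟩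
    · rintro n ⟨w, hw⟩
      obtain ⟨m, hm⟩ : ∃ m, ¬ R m n := by
        by_contra! hn
        obtain ⟨n', hn', h'⟩ := hno n hn
        obtain ⟨m, -, hm⟩ := hw n' hn'
        exact hm (h' m)
      refine ⟨w + (m + 1), fun y hy => ?_⟩
      rcases (Order.lt_add_one_iff.1 hy).eq_or_lt with rfl | hy
      · exact ⟨m, (lt_add_one m).trans_le le_add_self, hm⟩
      · exact (hw y hy).imp fun m' h => ⟨h.1.trans_le le_self_add, h.2⟩
  obtain ⟨w, hw⟩ := bounded_counterexamples (a + 1)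
  obtain ⟨m, -, hm⟩ := hw a (lt_add_one a)
  exact hm (ha m)

theorem exists_least (R : M → Prop) [BddDefinable S fun v => R (v 0)] {a : M} (ha : R a) :
    ∃ n, R n ∧ ∀ n' < n, ¬ R n' := by
  have : BddDefinable S fun v => R (v 1) := .reindex (P := fun v => R (v 0)) fun _ => 1
  simpa using hM.exists_least_of_forall (fun _ n => R n) fun _ => ha

theorem bounded_sigma_comprehension (R : M → M → Prop) [BddDefinable S fun v => R (v 0) (v 1)]
    (b : M) : {x | x < b ∧ ∃ m, R m x} ∈ S := by
  have := hM.isDiscretelyOrdered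
  have : BddDefinable S fun v => R (v 1) (v 0) :=
    .reindex (P := fun v => R (v 0) (v 1)) fun i => 1 - i
  obtain ⟨d, hd0, hd⟩ : ∃ d, d ≠ 0 ∧ ∀ i < b, i + 1 ∣ d :=
    hM.exists_common_multiple _ (fun i => by simp) b
  obtain ⟨a, ha0, ha⟩ : ∃ a, a ≠ 0 ∧ ∀ i < b, d * (i + 1) + 1 ∣ a :=
    hM.exists_common_multiple _ (fun i => by simp) b
  -- The multiples of the least such `e` involve only the moduli that they have to involve: dividing
  -- `e` by any other modulus would give a smaller number with the same property.
  obtain ⟨e, he, hmin⟩ := hM.exists_least_of_forall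
    (fun m e => ¬ e = 0 ∧ ∀ x < b, R m x → d * (x + 1) + 1 ∣ e)
    fun _ => ⟨ha0, fun x hx _ => ha x hx⟩
  have mem_iff (x : M) : (x < b ∧ ∃ m, R m x) ↔ x < b ∧ d * (x + 1) + 1 ∣ e := by
    refine and_congr_right fun hx => ⟨fun ⟨m, hm⟩ => (he m).2 x hx hm, ?_⟩
    rintro ⟨q, rfl⟩
    by_contra! hxR
    have hq0 : q ≠ 0 := right_ne_zero_of_mul (he 0).1
    have hlt : q < (d * (x + 1) + 1) * q :=
      lt_mul_of_one_lt_left (pos_iff_ne_zero.2 hq0)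
        (lt_add_of_pos_left 1 (pos_iff_ne_zero.2 (by simp [hd0])))
    obtain ⟨m, hm⟩ := hmin q hlt
    refine hm ⟨hq0, fun y hy hyR => ?_⟩
    exact dvd_of_dvd_modulus_mul hd hx hy (by rintro rfl; exact hxR m hyR) ((he m).2 y hy hyR)
  simp only [mem_iff]
  exact hM.bdd_comprehension fun x => x < b ∧ d * (x + 1) + 1 ∣ e

end IsModelRCA0

end Comprehension

/-! ## Functions -/

section Functions

variable {M : Type*} [CommSemiring M] [LinearOrder M] [IsStrictOrderedRing M] {S : Set (Set M)}

namespace IsModelRCA0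

variable (hM : IsModelRCA0 M S)
include hM

theorem exists_pair_mem_iff (R : M → M → Prop) [BddDefinable S fun v => R (v 0) (v 1)] :
    ∃ F ∈ S, F ⊆ prod Set.univ Set.univ ∧ ∀ a b, pair a b ∈ F ↔ R a b := by
  have := hM.isDiscretelyOrdered
  have : BddDefinable S fun v => R (v 1) (v 0) :=
    .reindex (P := fun v => R (v 0) (v 1)) fun i => 1 - i
  refine ⟨_, hM.bdd_comprehension fun p => ∃ a b, p = pair a b ∧ R a b,
    fun p ⟨a, b, hp, _⟩ => ⟨a, trivial, b, trivial, hp⟩, fun a b => ?_⟩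
  constructor
  · rintro ⟨a', b', hp, h⟩
    obtain ⟨rfl, rfl⟩ := pair_inj.1 hp
    exact h
  · exact fun h => ⟨a, b, rfl, h⟩

theorem univ_mem : Set.univ ∈ S := by
  simpa using hM.bdd_comprehension fun a => a = a

theorem prod_mem {A B : Set M} (hA : A ∈ S) (hB : B ∈ S) : prod A B ∈ S := by
  have : Fact (A ∈ S) := ⟨hA⟩
  have : Fact (B ∈ S) := ⟨hB⟩
  obtain ⟨F, hF, hFsub, mem_F⟩ := hM.exists_pair_mem_iff fun a b => a ∈ A ∧ b ∈ B
  convert hF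
  ext p
  constructor
  · rintro ⟨a, ha, b, hb, rfl⟩
    exact (mem_F a b).2 ⟨ha, hb⟩
  · intro hp
    obtain ⟨a, -, b, -, rfl⟩ := hFsub hp
    exact ⟨a, ((mem_F a b).1 hp).1, b, ((mem_F a b).1 hp).2, rfl⟩

theorem exists_isFunction {A B : Set M} (R : M → M → Prop)
    [BddDefinable S fun v => R (v 0) (v 1)] (hAB : ∀ a b, R a b → a ∈ A ∧ b ∈ B)
    (hR : ∀ a ∈ A, ∃! b, R a b) :
    ∃ F ∈ S, IsFunction F A B ∧ ∀ a b, pair a b ∈ F ↔ R a b := by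
  obtain ⟨F, hF, hFsub, mem_F⟩ := hM.exists_pair_mem_iff R
  refine ⟨F, hF, ⟨fun p hp => ?_, by simpa only [mem_F] using hR⟩, mem_F⟩
  obtain ⟨a, -, b, -, rfl⟩ := hFsub hp
  exact ⟨a, (hAB a b ((mem_F a b).1 hp)).1, b, (hAB a b ((mem_F a b).1 hp)).2, rfl⟩

theorem exists_isFunction_extension {F A B : Set M} (hF : F ∈ S) (hA : A ∈ S)
    (hfun : IsFunction F A B) {c : M} (hc : c ∈ B) : ∃ F' ∈ S, IsFunction F' Set.univ B ∧
      ∀ a b, pair a b ∈ F' ↔ pair a b ∈ F ∨ a ∉ A ∧ b = c := by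
  have := hM.isDiscretelyOrdered
  have : Fact (F ∈ S) := ⟨hF⟩
  have : Fact (A ∈ S) := ⟨hA⟩
  have hdom {a b : M} (h : pair a b ∈ F) : a ∈ A ∧ b ∈ B := by
    obtain ⟨a', ha, b', hb, hp⟩ := hfun.1 h
    obtain ⟨rfl, rfl⟩ := pair_inj.1 hp
    exact ⟨ha, hb⟩
  refine hM.exists_isFunction (fun a b => pair a b ∈ F ∨ ¬ a ∈ A ∧ b = c) ?_ fun a _ => ?_
  · rintro a b (h | ⟨-, rfl⟩)
    exacts [⟨trivial, (hdom h).2⟩, ⟨trivial, hc⟩]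
  · by_cases ha : a ∈ A
    · simpa only [ha, not_true_eq_false, false_and, or_false] using hfun.2 a ha
    · exact ⟨c, .inr ⟨ha, rfl⟩, fun b hb => hb.elim (fun h => absurd (hdom h).1 ha) And.right⟩

end IsModelRCA0

end Functions

/-! ## Sequences of sets -/

section Sequences

/-- The `n`-th set of the sequence of sets that is coded by the set `U` of the pairs `(x, n)` with
`x` in the `n`-th set. -/
def nth {M : Type*} [CommSemiring M] (U : Set M) (n : M) : Set M := {x | pair x n ∈ U}

variable {M : Type*} [CommSemiring M] [LinearOrder M] [IsStrictOrderedRing M] {S : Set (Set M)}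

instance BddDefinable.mem_nth {s t : (ℕ → M) → M} [TermDefinable s] [TermDefinable t] (U : Set M)
    [Fact (U ∈ S)] : BddDefinable S fun v => s v ∈ nth U (t v) :=
  BddDefinable.mem (t := fun v => pair (s v) (t v)) U

namespace IsModelRCA0

variable (hM : IsModelRCA0 M S)
include hM

theorem exists_mem_nth_iff (R : M → M → Prop) [BddDefinable S fun v => R (v 0) (v 1)] :
    ∃ V ∈ S, ∀ n x, x ∈ nth V n ↔ R n x := by
  have : BddDefinable S fun v => R (v 1) (v 0) :=
    .reindex (P := fun v => R (v 0) (v 1)) fun i => 1 - i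
  obtain ⟨V, hV, -, mem_V⟩ := hM.exists_pair_mem_iff fun x n => R n x
  exact ⟨V, hV, fun n x => mem_V x n⟩

/-- The subset consists of the records of the enumeration, the numbers that exceed all the numbers
enumerated before them. An enumerated number is enumerated after a stage greater than itself, so
only boundedly many numbers precede a given one, and being a record is a `Δ⁰₁` property. -/
theorem exists_isCofinal_subset_of_lt {V : Set M} (hV : V ∈ S) (hlt : ∀ n, ∀ x ∈ nth V n, x < n)
    (hcof : IsCofinal (⋃ n, nth V n)) : ∃ Y ∈ S, Y ⊆ ⋃ n, nth V n ∧ IsCofinal Y := by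
  have := hM.isDiscretelyOrdered
  have : Fact (V ∈ S) := ⟨hV⟩
  have hdelta (x : M) : (∃ n, x ∈ nth V n ∧ ∀ m < n, ∀ y < m, x < y → y ∉ nth V m) ↔
      ∀ m, ∀ y < m, x ≤ y → y ∈ nth V m →
        ∃ n < m + 1, x ∈ nth V n ∧ ∀ m' < n, ∀ y < m', x < y → y ∉ nth V m' := by
    constructor
    · rintro ⟨n, hn, hrec⟩ m y hym hxy hy
      rcases le_or_gt n m with hnm | hmn
      · exact ⟨n, Order.lt_add_one_iff.2 hnm, hn, hrec⟩
      · obtain rfl : x = y := hxy.eq_of_not_lt fun hlt => hrec m hmn y hym hlt hy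
        exact ⟨m, lt_add_one m, hy, fun m' hm' => hrec m' (hm'.trans hmn)⟩
    · intro h
      obtain ⟨y, hy, hxy⟩ := hcof x
      obtain ⟨m, hm⟩ := Set.mem_iUnion.1 hy
      exact (h m y (hlt m y hm) hxy hm).imp fun _ => And.right
  refine ⟨_, hM.delta_comprehension
    (fun n x => x ∈ nth V n ∧ ∀ m < n, ∀ y < m, x < y → y ∉ nth V m) _ hdelta,
    fun x ⟨n, hn, _⟩ => Set.mem_iUnion.2 ⟨n, hn⟩, fun b => ?_⟩
  obtain ⟨x, hx, hbx⟩ := hcof b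
  obtain ⟨n, hn⟩ := Set.mem_iUnion.1 hx
  obtain ⟨n, ⟨x, _, hbx, hn⟩, hmin⟩ :=
    hM.exists_least (fun n => ∃ x < n, b ≤ x ∧ x ∈ nth V n) ⟨x, hlt n x hn, hbx, hn⟩
  exact ⟨x, ⟨n, hn, fun m hm y hym hxy hy => hmin m hm ⟨y, hym, hbx.trans hxy.le, hy⟩⟩, hbx⟩

theorem exists_isCofinal_subset {V : Set M} (hV : V ∈ S) (hcof : IsCofinal (⋃ n, nth V n)) :
    ∃ Y ∈ S, Y ⊆ ⋃ n, nth V n ∧ IsCofinal Y := by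
  have := hM.isDiscretelyOrdered
  have : Fact (V ∈ S) := ⟨hV⟩
  obtain ⟨W, hW, mem_W⟩ := hM.exists_mem_nth_iff fun n x => x < n ∧ ∃ m < n, x ∈ nth V m
  have iUnion_W : ⋃ n, nth W n = ⋃ n, nth V n := by
    ext x
    simp only [Set.mem_iUnion, mem_W]
    refine ⟨fun ⟨_, _, m, _, hm⟩ => ⟨m, hm⟩, fun ⟨m, hm⟩ => ⟨x + (m + 1), ?_, m, ?_, hm⟩⟩
    · exact lt_add_of_pos_right x (Order.lt_add_one_iff.2 zero_le)
    · exact (lt_add_one m).trans_le le_add_self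
  rw [← iUnion_W] at hcof ⊢
  exact hM.exists_isCofinal_subset_of_lt hW (fun n x hx => ((mem_W n x).1 hx).1) hcof

theorem exists_iUnion_nth_subset {W : Set M} (hW : W ∈ S) (hmono : Monotone (nth W))
    (hsub : ∀ Y ∈ S, Y ⊆ ⋃ n, nth W n → ∃ N, Y ⊆ nth W N) : ∃ N, ⋃ n, nth W n ⊆ nth W N := by
  have : Fact (W ∈ S) := ⟨hW⟩
  obtain ⟨c, hc⟩ := hsub _ (hM.bdd_comprehension fun x => x ∈ nth W x)
    fun x hx => Set.mem_iUnion.2 ⟨x, hx⟩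
  have lt_of_notMem {n x : M} (hn : x ∈ nth W n) (hx : x ∉ nth W c) : x < n :=
    not_le.1 fun hnx => hx (hc (hmono hnx hn))
  obtain ⟨V, hV, mem_V⟩ := hM.exists_mem_nth_iff fun n x => x ∈ nth W n ∧ x ∉ nth W c
  have hVW : ⋃ n, nth V n ⊆ ⋃ n, nth W n := Set.iUnion_mono fun n x hx => ((mem_V n x).1 hx).1
  have hbdd : ¬ IsCofinal (⋃ n, nth V n) := fun hcof => by
    obtain ⟨Y, hYS, hYV, hYcof⟩ := hM.exists_isCofinal_subset hV hcof
    obtain ⟨N, hN⟩ := hsub Y hYS (hYV.trans hVW)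
    obtain ⟨x, hx, hNx⟩ := hYcof N
    obtain ⟨n, hn⟩ := Set.mem_iUnion.1 (hYV hx)
    exact (lt_of_notMem (hN hx) ((mem_V n x).1 hn).2).not_ge hNx
  obtain ⟨b, hb⟩ := not_isCofinal_iff.1 hbdd
  have : Fact (_ ∈ S) := ⟨hM.bounded_sigma_comprehension (fun n x => x ∈ nth W n) b⟩
  obtain ⟨N, hN⟩ := hsub _ (hM.bdd_comprehension fun x =>
      x ∈ {x | x < b ∧ ∃ n, x ∈ nth W n} ∨ x ∈ nth W c) <| by
    rintro x (⟨-, hx⟩ | hx)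
    exacts [Set.mem_iUnion.2 hx, Set.mem_iUnion.2 ⟨c, hx⟩]
  refine ⟨N, fun x hx => hN ?_⟩
  obtain ⟨n, hn⟩ := Set.mem_iUnion.1 hx
  by_cases hxc : x ∈ nth W c
  · exact .inr hxc
  · exact .inl ⟨hb x (Set.mem_iUnion.2 ⟨n, (mem_V n x).2 ⟨hn, hxc⟩⟩), n, hn⟩

end IsModelRCA0

end Sequences

/-! ## Effectively open sets -/

section EffOpen

variable {M : Type*} [CommSemiring M]

/-- The union of the `U i` over the `i` in the finite set coded by `e`. -/
def SpaceData.finUnion [LinearOrder M] (D : SpaceData M) (e : M) : Set M :=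
  {x | ∃ i ∈ decode e, x ∈ D.basic i}

variable [LinearOrder M] {S : Set (Set M)} {D : SpaceData M} {g h Y : Set M}

namespace SpaceData

theorem mem_effOpen {x : M} : x ∈ D.effOpen h ↔ ∃ n e, pair n e ∈ h ∧ x ∈ D.finUnion e := by
  simp only [effOpen, finUnion, Set.mem_ofPred_eq, exists_and_left]

theorem mem_effOpenBelow {x N : M} :
    x ∈ D.effOpenBelow h N ↔ ∃ n < N, ∃ e, pair n e ∈ h ∧ x ∈ D.finUnion e := by
  simp only [effOpenBelow, finUnion, Set.mem_ofPred_eq, exists_and_left]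

theorem monotone_effOpenBelow : Monotone (D.effOpenBelow h) :=
  fun _ _ hN _ ⟨n, e, i, hn, hx⟩ => ⟨n, e, i, hn.trans_le hN, hx⟩

end SpaceData

variable [IsStrictOrderedRing M]

instance BddDefinable.mem_finUnion [IsDiscretelyOrdered M] {s t : (ℕ → M) → M}
    [hs : TermDefinable s] [ht : TermDefinable t] [Fact (D.U ∈ S)] :
    BddDefinable S fun v => s v ∈ D.finUnion (t v) :=
  have : TermDefinable fun u => s fun i => u (i + 1) := hs.reindex (· + 1)
  have : TermDefinable fun u => t fun i => u (i + 1) := ht.reindex (· + 1)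
  (inferInstance : BddDefinable S fun v => ∃ i < t v, i ∈ decode (t v) ∧ s v ∈ nth D.U i).congr
    fun _ => ⟨fun ⟨i, _, h⟩ => ⟨i, h⟩, fun ⟨i, h⟩ => ⟨i, lt_of_mem_decode h.1, h⟩⟩

namespace SpaceData

theorem finUnion_zero [IsDiscretelyOrdered M] : D.finUnion 0 = ∅ := by
  simp [finUnion, decode_zero]

theorem iUnion_effOpenBelow : ⋃ n, D.effOpenBelow h n = D.effOpen h := by
  ext x
  simp only [Set.mem_iUnion, mem_effOpenBelow, mem_effOpen]
  exact ⟨fun ⟨_, n, _, hx⟩ => ⟨n, hx⟩, fun ⟨n, hx⟩ => ⟨n + 1, n, lt_add_one n, hx⟩⟩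

theorem effOpenBelow_subset (N : M) : D.effOpenBelow h N ⊆ D.effOpen h :=
  iUnion_effOpenBelow (D := D) ▸ Set.subset_iUnion _ N

theorem mem_effOpen_row [IsDiscretelyOrdered M] {n x : M} : x ∈ D.effOpen (row g n) ↔
    ∃ m e, pair (pair n m) e ∈ g ∧ x ∈ D.finUnion e := by
  rw [mem_effOpen]
  constructor
  · rintro ⟨_, _, ⟨m, e, hp, hg⟩, hx⟩
    obtain ⟨rfl, rfl⟩ := pair_inj.1 hp
    exact ⟨_, _, hg, hx⟩
  · exact fun ⟨m, e, hg, hx⟩ => ⟨m, e, ⟨m, e, rfl, hg⟩, hx⟩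

section Subspace

variable [IsDiscretelyOrdered M] (hUX : D.U ⊆ prod D.X D.I)
include hUX

theorem effOpen_subset : D.effOpen h ⊆ D.X := by
  rintro x ⟨n, e, i, -, -, hx⟩
  obtain ⟨a, ha, b, -, hab⟩ := hUX hx
  exact (pair_inj.1 hab).1 ▸ ha

theorem effClosed_subset_effClosed :
    D.effClosed g ⊆ D.effClosed h ↔ D.effOpen h ⊆ D.effOpen g :=
  Set.sdiff_subset_sdiff_iff_subset (effOpen_subset hUX) (effOpen_subset hUX)

theorem effClosed_eq_effClosed : D.effClosed g = D.effClosed h ↔ D.effOpen g = D.effOpen h := by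
  simp only [Set.Subset.antisymm_iff, effClosed_subset_effClosed hUX, and_comm]

theorem basic_subspace (i : M) : (D.subspace Y).basic i = Y ∩ D.basic i := by
  ext x
  constructor
  · rintro ⟨hx, y, hy, j, -, hxy⟩
    exact ⟨(pair_inj.1 hxy).1 ▸ hy, hx⟩
  · rintro ⟨hxY, hx⟩
    obtain ⟨a, -, b, hb, hab⟩ := hUX hx
    exact ⟨hx, x, hxY, i, (pair_inj.1 hab).2 ▸ hb, rfl⟩

theorem effOpenBelow_subspace (N : M) :
    (D.subspace Y).effOpenBelow h N = Y ∩ D.effOpenBelow h N := by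
  ext x
  simp only [effOpenBelow, basic_subspace hUX, Set.mem_ofPred_eq, Set.mem_inter_iff]
  tauto

theorem effOpen_subspace : (D.subspace Y).effOpen h = Y ∩ D.effOpen h := by
  simp only [← iUnion_effOpenBelow, effOpenBelow_subspace hUX, Set.inter_iUnion]

theorem isCompact_subspace
    (hfin : ∀ h, D.IsCode S h → ∃ N, D.effOpen h = D.effOpenBelow h N) (Y : Set M) :
    (D.subspace Y).IsCompact S := fun h hh hY =>
  (hfin h hh).imp fun N hN => by
    rw [effOpenBelow_subspace hUX, ← hN, ← effOpen_subspace hUX, ← hY]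

end Subspace

theorem exists_nth_eq_effOpenBelow (hM : IsModelRCA0 M S) (hU : D.U ∈ S) (hh : D.IsCode S h) :
    ∃ W ∈ S, nth W = D.effOpenBelow h := by
  have := hM.isDiscretelyOrdered
  have : Fact (D.U ∈ S) := ⟨hU⟩
  have : Fact (h ∈ S) := ⟨hh.1⟩
  have hV := hM.delta_comprehension
    (fun e p => ∃ x n, p = pair x n ∧ pair n e ∈ h ∧ x ∈ D.finUnion e)
    (fun e p => ∃ x n, p = pair x n ∧ (pair n e ∈ h → x ∈ D.finUnion e)) fun p => by
      constructor
      · rintro ⟨e, x, n, rfl, he, hx⟩ e'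
        exact ⟨x, n, rfl, fun he' => (hh.2.2 n trivial).unique he he' ▸ hx⟩
      · intro H
        obtain ⟨x, n, rfl, -⟩ := H 0
        obtain ⟨e, he, -⟩ := hh.2.2 n trivial
        obtain ⟨x', n', hp, hx⟩ := H e
        obtain ⟨rfl, rfl⟩ := pair_inj.1 hp
        exact ⟨e, x, n, rfl, he, hx he⟩
  set V := {p | ∃ e x n, p = pair x n ∧ pair n e ∈ h ∧ x ∈ D.finUnion e}
  have mem_V (n x : M) : x ∈ nth V n ↔ ∃ e, pair n e ∈ h ∧ x ∈ D.finUnion e := by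
    refine ⟨?_, fun ⟨e, hx⟩ => ⟨e, x, n, rfl, hx⟩⟩
    rintro ⟨e, x', n', hp, hx⟩
    obtain ⟨rfl, rfl⟩ := pair_inj.1 hp
    exact ⟨e, hx⟩
  have : Fact (V ∈ S) := ⟨hV⟩
  obtain ⟨W, hW, mem_W⟩ := hM.exists_mem_nth_iff fun N x => ∃ n < N, x ∈ nth V n
  refine ⟨W, hW, ?_⟩
  ext N x
  simp only [mem_W, mem_V, mem_effOpenBelow]

theorem exists_effOpen_eq_effOpenBelow_of_isCompact_subspace (hM : IsModelRCA0 M S) (hU : D.U ∈ S)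
    (hUX : D.U ⊆ prod D.X D.I) (hcpt : ∀ Y ∈ S, Y ⊆ D.X → (D.subspace Y).IsCompact S)
    (hh : D.IsCode S h) : ∃ N, D.effOpen h = D.effOpenBelow h N := by
  have := hM.isDiscretelyOrdered
  obtain ⟨W, hW, nth_W⟩ := exists_nth_eq_effOpenBelow hM hU hh
  obtain ⟨N, hN⟩ := hM.exists_iUnion_nth_subset hW (nth_W ▸ monotone_effOpenBelow) <| by
    intro Y hY hYh
    rw [nth_W] at hYh ⊢
    rw [iUnion_effOpenBelow] at hYh
    have hcover : Y = (D.subspace Y).effOpen h := by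
      rw [effOpen_subspace hUX, Set.inter_eq_left.2 hYh]
    refine (hcpt Y hY (hYh.trans (effOpen_subset hUX)) h hh hcover).imp fun N hN => ?_
    rw [effOpenBelow_subspace hUX] at hN
    exact Set.left_eq_inter.1 hN
  rw [nth_W, iUnion_effOpenBelow] at hN
  exact ⟨N, hN.antisymm (effOpenBelow_subset N)⟩

theorem monotone_effOpen_row (hM : IsModelRCA0 M S) (hU : D.U ∈ S) (hg : g ∈ S)
    (hmono : ∀ n, D.effOpen (row g n) ⊆ D.effOpen (row g (n + 1))) :
    Monotone fun n => D.effOpen (row g n) := by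
  have := hM.isDiscretelyOrdered
  have : Fact (D.U ∈ S) := ⟨hU⟩
  have : Fact (g ∈ S) := ⟨hg⟩
  intro n n' hn x hx
  obtain ⟨d, rfl⟩ := exists_add_of_le hn
  have mem_iff (n : M) : x ∈ D.effOpen (row g n) ↔
      ∃ q m e, q = pair m e ∧ pair (pair n m) e ∈ g ∧ x ∈ D.finUnion e := by
    rw [mem_effOpen_row]
    exact ⟨fun ⟨m, e, h⟩ => ⟨_, m, e, rfl, h⟩, fun ⟨_, m, e, _, h⟩ => ⟨m, e, h⟩⟩
  refine (mem_iff _).2 <| hM.sigma_induction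
    (fun q d => ∃ m e, q = pair m e ∧ pair (pair (n + d) m) e ∈ g ∧ x ∈ D.finUnion e) ?_ ?_ d
  · rwa [← mem_iff, add_zero]
  · intro d hd
    rw [← mem_iff] at hd ⊢
    exact add_assoc n d 1 ▸ hmono _ hd

theorem exists_isCode_of_isSeqCode (hM : IsModelRCA0 M S) (hg : D.IsSeqCode S g) :
    ∃ h, D.IsCode S h ∧ (∀ n, D.effOpen (row g n) ⊆ D.effOpen h) ∧
      ∀ N, D.effOpenBelow h N ⊆ ⋃ n < N, D.effOpen (row g n) := by
  have := hM.isDiscretelyOrdered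
  obtain ⟨h, hhS, hhfun, mem_h⟩ := hM.exists_isFunction_extension hg.1
    (hM.prod_mem hM.univ_mem hM.univ_mem) hg.2 (zero_mem_finSubsets D.I)
  refine ⟨h, ⟨hhS, hhfun⟩, fun n x hx => ?_, fun N x hx => ?_⟩
  · obtain ⟨m, e, he, hx⟩ := mem_effOpen_row.1 hx
    exact mem_effOpen.2 ⟨_, e, (mem_h _ _).2 (.inl he), hx⟩
  · obtain ⟨p, hp, e, he, hx⟩ := mem_effOpenBelow.1 hx
    rcases (mem_h p e).1 he with he | ⟨-, rfl⟩
    · obtain ⟨_, ⟨n, -, m, -, rfl⟩, b, -, hab⟩ := hg.2.1 he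
      obtain ⟨rfl, rfl⟩ := pair_inj.1 hab
      exact Set.mem_iUnion₂.2
        ⟨n, (le_pair_left n m).trans_lt hp, mem_effOpen_row.2 ⟨m, e, he, hx⟩⟩
    · simp only [finUnion_zero, Set.mem_empty_iff_false] at hx

theorem exists_effOpen_row_eq (hM : IsModelRCA0 M S) (hU : D.U ∈ S)
    (hfin : ∀ h, D.IsCode S h → ∃ N, D.effOpen h = D.effOpenBelow h N) (hg : D.IsSeqCode S g)
    (hmono : ∀ n, D.effOpen (row g n) ⊆ D.effOpen (row g (n + 1))) :
    ∃ N, ∀ n > N, D.effOpen (row g n) = D.effOpen (row g N) := by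
  have hmono := monotone_effOpen_row hM hU hg.1 hmono
  obtain ⟨h, hh, hrow, hbelow⟩ := exists_isCode_of_isSeqCode hM hg
  obtain ⟨N, hN⟩ := hfin h hh
  refine ⟨N, fun n hn => (hmono hn.le).antisymm' ?_⟩
  calc D.effOpen (row g n) ⊆ D.effOpen h := hrow n
    _ = D.effOpenBelow h N := hN
    _ ⊆ ⋃ n < N, D.effOpen (row g n) := hbelow N
    _ ⊆ D.effOpen (row g N) := Set.iUnion₂_subset fun n hn => hmono hn.le

theorem exists_isSeqCode_effOpen_row_eq (hM : IsModelRCA0 M S) (hh : D.IsCode S h) :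
    ∃ g, D.IsSeqCode S g ∧ ∀ n, D.effOpen (row g n) = D.effOpenBelow h n := by
  have := hM.isDiscretelyOrdered
  have : Fact (h ∈ S) := ⟨hh.1⟩
  have mem_finSubsets {m e : M} (h' : pair m e ∈ h) : e ∈ finSubsets D.I := by
    obtain ⟨_, -, _, he, hp⟩ := hh.2.1 h'
    exact (pair_inj.1 hp).2 ▸ he
  have R_iff (n m e : M) : (∃ n' m', pair n m = pair n' m' ∧
      (m' < n' ∧ pair m' e ∈ h ∨ n' ≤ m' ∧ e = 0)) ↔ m < n ∧ pair m e ∈ h ∨ n ≤ m ∧ e = 0 := by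
    refine ⟨?_, fun H => ⟨n, m, rfl, H⟩⟩
    rintro ⟨n', m', hp, H⟩
    obtain ⟨rfl, rfl⟩ := pair_inj.1 hp
    exact H
  obtain ⟨g, hgS, hgfun, mem_g⟩ := hM.exists_isFunction
    (A := prod Set.univ Set.univ) (B := finSubsets D.I)
    (fun p e => ∃ n m, p = pair n m ∧ (m < n ∧ pair m e ∈ h ∨ n ≤ m ∧ e = 0))
    (by
      rintro _ e ⟨n, m, rfl, ⟨-, he⟩ | ⟨-, rfl⟩⟩
      exacts [⟨⟨n, trivial, m, trivial, rfl⟩, mem_finSubsets he⟩,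
        ⟨⟨n, trivial, m, trivial, rfl⟩, zero_mem_finSubsets _⟩])
    (by
      rintro _ ⟨n, -, m, -, rfl⟩
      simp only [R_iff]
      rcases lt_or_ge m n with hmn | hnm
      · simpa only [hmn, hmn.not_ge, true_and, false_and, or_false] using hh.2.2 m trivial
      · simp only [hnm, hnm.not_gt, true_and, false_and, false_or]
        exact ⟨0, rfl, fun _ => id⟩)
  refine ⟨g, ⟨hgS, hgfun⟩, fun n => ?_⟩
  ext x
  simp only [mem_effOpen_row, mem_effOpenBelow, mem_g, R_iff]
  constructor
  · rintro ⟨m, e, ⟨hmn, he⟩ | ⟨-, rfl⟩, hx⟩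
    · exact ⟨m, hmn, e, he, hx⟩
    · simp only [finUnion_zero, Set.mem_empty_iff_false] at hx
  · exact fun ⟨m, hmn, e, he, hx⟩ => ⟨m, e, .inl ⟨hmn, he⟩, hx⟩

theorem exists_effOpen_eq_effOpenBelow_of_row (hM : IsModelRCA0 M S)
    (hstab : ∀ g, D.IsSeqCode S g →
      (∀ n, D.effOpen (row g n) ⊆ D.effOpen (row g (n + 1))) →
      ∃ N, ∀ n > N, D.effOpen (row g n) = D.effOpen (row g N)) (hh : D.IsCode S h) :
    ∃ N, D.effOpen h = D.effOpenBelow h N := by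
  obtain ⟨g, hg, row_eq⟩ := exists_isSeqCode_effOpen_row_eq hM hh
  obtain ⟨N, hN⟩ := hstab g hg fun n => by
    simpa only [row_eq] using monotone_effOpenBelow (lt_add_one n).le
  simp only [row_eq] at hN
  refine ⟨N, Set.Subset.antisymm ?_ (effOpenBelow_subset N)⟩
  rw [← iUnion_effOpenBelow]
  refine Set.iUnion_subset fun n => ?_
  rcases le_or_gt n N with hn | hn
  · exact monotone_effOpenBelow hn
  · exact (hN n hn).subset

end SpaceData

end EffOpen

end RevMath

open RevMath.SpaceData in
theorem proposition3p1_general {M : Type*} [CommSemiring M] [LinearOrder M] [IsStrictOrderedRing M]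
    (S : Set (Set M)) (hM : RevMath.IsModelRCA0 M S)
    (D : RevMath.SpaceData M) (hU : D.U ∈ S) (hUX : D.U ⊆ RevMath.prod D.X D.I) :
    List.TFAE [
      ∀ h, D.IsCode S h → D.IsCompactEffOpen S h,
      ∀ h, D.IsCode S h → ∃ N : M, D.effOpen h = D.effOpenBelow h N,
      ∀ Y ∈ S, Y ⊆ D.X → (D.subspace Y).IsCompact S,
      ∀ g, D.IsSeqCode S g →
        (∀ n : M, D.effOpen (RevMath.row g n) ⊆ D.effOpen (RevMath.row g (n + 1))) →
        ∃ N : M, ∀ n > N, D.effOpen (RevMath.row g n) = D.effOpen (RevMath.row g N),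
      ∀ g, D.IsSeqCode S g →
        (∀ n : M, D.effClosed (RevMath.row g n) ⊇ D.effClosed (RevMath.row g (n + 1))) →
        ∃ N : M, ∀ n > N, D.effClosed (RevMath.row g n) = D.effClosed (RevMath.row g N)] := by
  have := hM.isDiscretelyOrdered
  tfae_have 1 → 2 := fun hcpt h hh =>
    (hcpt h hh h hh subset_rfl).imp fun N hN => hN.antisymm (effOpenBelow_subset N)
  tfae_have 2 → 1 := fun hfin h _ f hf hhf => (hfin f hf).imp fun N hN => hhf.trans hN.subset
  tfae_have 2 → 3 := fun hfin Y _ _ => isCompact_subspace hUX hfin Y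
  tfae_have 3 → 2 := fun hcpt h hh =>
    exists_effOpen_eq_effOpenBelow_of_isCompact_subspace hM hU hUX hcpt hh
  tfae_have 2 → 4 := fun hfin g hg hmono => exists_effOpen_row_eq hM hU hfin hg hmono
  tfae_have 4 → 2 := fun hstab h hh => exists_effOpen_eq_effOpenBelow_of_row hM hstab hh
  tfae_have 4 ↔ 5 := forall₂_congr fun g _ => imp_congr
    (forall_congr' fun _ => (effClosed_subset_effClosed hUX).symm)
    (exists_congr fun _ => forall₂_congr fun _ _ => (effClosed_eq_effClosed hUX).symm)
  tfae_finish

theorem proposition3p1 {M : Type*} [CommSemiring M] [LinearOrder M] [IsStrictOrderedRing M]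
    (S : Set (Set M)) (hM : RevMath.IsModelRCA0 M S)
    (D : RevMath.SpaceData M) (hD : RevMath.IsCSCSpace S D) :
    List.TFAE [
      ∀ h, D.IsCode S h → D.IsCompactEffOpen S h,
      ∀ h, D.IsCode S h → ∃ N : M, D.effOpen h = D.effOpenBelow h N,
      ∀ Y ∈ S, Y ⊆ D.X → (D.subspace Y).IsCompact S,
      ∀ g, D.IsSeqCode S g →
        (∀ n : M, D.effOpen (RevMath.row g n) ⊆ D.effOpen (RevMath.row g (n + 1))) →
        ∃ N : M, ∀ n > N, D.effOpen (RevMath.row g n) = D.effOpen (RevMath.row g N),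
      ∀ g, D.IsSeqCode S g →
        (∀ n : M, D.effClosed (RevMath.row g n) ⊇ D.effClosed (RevMath.row g (n + 1))) →
        ∃ N : M, ∀ n > N, D.effClosed (RevMath.row g n) = D.effClosed (RevMath.row g N)] :=
  proposition3p1_general S hM D hD.mem_U hD.U_subset
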